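/- Let $p\ge 0$ and let $Z$ be a symmetric reflexive zigzag of genus $p$, that is: * $Z$ is a properly embedded arc in $\mathbb C$ with $2p+1$ vertices $P_{-p},\dots,P_p$ and alternating vertical and horizontal sides. It starts with an infinite vertical side coming down to $P_{-p}$ and ends with an infinite horizontal side going right from $P_p$; the angles on its north-east side at $P_{-p},\dots,P_p$ are alternately $\frac{\pi}{2},\frac{3\pi}{2},\frac{\pi}{2},\dots,\frac{3\pi}{2},\frac{\pi}{2}$. $Z$ separates $\mathbb C$ into a north-east region $\Omega_{NE}$ and a south-west region $\Omega_{SW}$. * $Z$ is symmetric about the line $y=x$ (the reflection exchanges $P_j$ and $P_{-j}$). * There is a conformal map $\phi:\Omega_{NE}\to\Omega_{SW}$ whose boundary values satisfy $\phi(P_j)=P_{-j}$ for all $j$ and $\phi(\infty)=\infty$. Put $a_j=\pm\frac12$, alternating in $j$ with $a_{-p}=-\frac12$. Present $\Omega_{NE}$ as an ortho-disk: let $t_{-p}<\dots<t_p$ be real and $A,B\in\mathbb C$ such that the Schwarz–Christoffel map $$F(z)=A\int_i^z\prod_{j=-p}^p(\zeta-t_j)^{a_j}\,d\zeta+B$$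 maps the upper half plane bijectively onto $\Omega_{NE}$, with boundary value $P_j$ at $t_j$ (and $\infty$ at $\infty$). Let $$\mathcal R_{NE}\setminus\{P_\infty\}=\Big\{(z,w)\in\mathbb C^2:\ w^2=\prod_{j=-p}^p(z-t_j)\Big\}$$ be the once punctured hyperelliptic double cover of the double of $\Omega_{NE}$, and let $$\omega_{NE}=\frac{A\prod_{a_j=1/2}(z-t_j)}{w}\,dz,$$ the one-form on it which is $F'(z)\,dz=A\prod_j(z-t_j)^{a_j}\,dz$ on the sheet $w=\prod_j(z-t_j)^{1/2}$ over the upper half plane. Let $\alpha=e^{i\pi/4}\omega_{NE}$ and $\beta=e^{i\pi/4}\widetilde\phi^{*}\omega_{SW}$, where $\widetilde\phi^{*}\omega_{SW}=(\phi\circ F)'(z)\,dz$ on that sheet; choose a constant $c$ such that $\alpha\beta=dh^2$ for $dh=c\,dz$, and let $g=\alpha/dh$. The triple $(\mathcal R_{NE}\setminus\{P_\infty\},g,dh)$ is the Weierstrass data of the genus-$p$ maxface defined by $Z$; its singular set on the Riemann surface is $\{x\in\mathcal R_{NE}\setminus\{P_\infty\}:|g(x)|=1\}$. Finally let $$G(z)=\frac{A^2}{c^2}\prod_{j=-p}^p(z-t_j)^{2a_j},$$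 so that $g^2=iG$. If $G'(z)\neq0$ at every point $(z,w)$ of the singular set, then the singular set is the union of exactly $p+1$ pairwise disjoint loops, that is, of $p+1$ pairwise disjoint subsets each homeomorphic to the circle. -/

import Mathlib

open Complex Filter Topology Bornology

noncomputable section

/-- A zigzag of genus `p`. Its `2p+1` vertices `P_{-p}, …, P_p` are numbered here by
`k = j + p ∈ {0, …, 2p}`. The arc comes down an infinite vertical side to the vertex `0`; after that
it goes alternately east and south (so the angles on its north-east side are
`π/2, 3π/2, π/2, …, 3π/2, π/2`) until it leaves the last vertex along an infinite horizontal side.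
Such a descending staircase is automatically a properly embedded arc. -/
structure Zigzag (p : ℕ) where
  P : Fin (2 * p + 1) → ℂ
  east : ∀ k : Fin (2 * p), Even (k : ℕ) →
    (P k.castSucc).re < (P k.succ).re ∧ (P k.succ).im = (P k.castSucc).im
  south : ∀ k : Fin (2 * p), Odd (k : ℕ) →
    (P k.succ).re = (P k.castSucc).re ∧ (P k.succ).im < (P k.castSucc).im

namespace Zigzag

variable {p : ℕ}

/-- The arc itself: the infinite vertical side, the `2p` finite sides, the infinite horizontal
side. -/
def curve (Z : Zigzag p) : Set ℂ :=
  {z | ∃ s : ℝ, 0 ≤ s ∧ z = Z.P 0 + s * I} ∪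
  (⋃ k : Fin (2 * p), segment ℝ (Z.P k.castSucc) (Z.P k.succ)) ∪
  {z | ∃ s : ℝ, 0 ≤ s ∧ z = Z.P (Fin.last (2 * p)) + s}

/-- The component of the complement of the arc lying to its north-east. -/
def regionNE (Z : Zigzag p) : Set ℂ :=
  {z | ∃ q ∈ Z.curve, q.re < z.re ∧ q.im < z.im}

/-- The component of the complement of the arc lying to its south-west. -/
def regionSW (Z : Zigzag p) : Set ℂ :=
  {z | ∃ q ∈ Z.curve, z.re < q.re ∧ z.im < q.im}

/-- Symmetry about the line `y = x`. The reflection `x + iy ↦ y + ix` is `z ↦ i * conj z`; it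
reverses the arc. -/
def IsSymmetric (Z : Zigzag p) : Prop :=
  ∀ k, I * (starRingEnd ℂ) (Z.P k) = Z.P k.rev

/-- `φ` is a conformal map of the north-east region onto the south-west region whose boundary values
send the vertex `P_j` to `Q_j = P_{-j}` for all `j`, and `∞` to `∞`. A symmetric zigzag is reflexive
if such a `φ` exists. -/
structure IsReflexiveMap (Z : Zigzag p) (φ : ℂ → ℂ) : Prop where
  differentiableOn : DifferentiableOn ℂ φ Z.regionNE
  bijOn : Set.BijOn φ Z.regionNE Z.regionSW
  vertex : ∀ k, Tendsto φ (𝓝[Z.regionNE] (Z.P k)) (𝓝 (Z.P k.rev))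
  infinity : Tendsto φ (cobounded ℂ ⊓ 𝓟 Z.regionNE) (cobounded ℂ)

end Zigzag

/-- The exponents `a_j = ± 1/2`, alternating and starting with `a_{-p} = -1/2`. -/
def scExponent {p : ℕ} (k : Fin (2 * p + 1)) : ℝ :=
  if Even (k : ℕ) then -(1 / 2) else 1 / 2

/-- The integrand `∏ (z - t_j)^{a_j}` of the Schwarz–Christoffel map; on the upper half plane the
powers are the holomorphic branches with argument of `z - t_j` in `(0, π)`. -/
def scIntegrand {p : ℕ} (t : Fin (2 * p + 1) → ℝ) (z : ℂ) : ℂ :=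
  ∏ k, (z - t k) ^ (scExponent k : ℂ)

/-- The Schwarz–Christoffel map `z ↦ A ∫_i^z ∏ (ζ - t_j)^{a_j} dζ + B` of the upper half plane, the
integral being taken along the segment from `i` to `z`. -/
def scMap {p : ℕ} (t : Fin (2 * p + 1) → ℝ) (A B : ℂ) (z : ℂ) : ℂ :=
  A * (∫ s in (0 : ℝ)..1, scIntegrand t (I + s * (z - I)) * (z - I)) + B

/-- The north-east region of `Z`, with its flat metric and its vertices, is the ortho-disk with data
`t_{-p} < ⋯ < t_p`: the Schwarz–Christoffel map is a bijection of the open upper half plane onto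
the region, with boundary value `P_j` at `t_j` (and `∞` at `∞`, which follows from the formula). -/
structure Zigzag.IsOrthoDisk {p : ℕ} (Z : Zigzag p) (t : Fin (2 * p + 1) → ℝ) (A B : ℂ) :
    Prop where
  strictMono : StrictMono t
  bijOn : Set.BijOn (scMap t A B) {z | 0 < z.im} Z.regionNE
  vertex : ∀ k, Tendsto (scMap t A B) (𝓝[{z : ℂ | 0 < z.im}] (t k : ℂ)) (𝓝 (Z.P k))

/-- The surface `R_NE ∖ {P_∞}`. In the half-plane coordinate the double of the north-east region is
the Riemann sphere with marked points `t_j` and puncture `∞`; its hyperelliptic double cover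
branched over the `t_j` and `∞`, without the point over `∞`, is the smooth affine curve
`w ^ 2 = ∏ (z - t_j)`, with covering map `(z, w) ↦ z`. -/
def hyperellipticSurface {p : ℕ} (t : Fin (2 * p + 1) → ℝ) : Set (ℂ × ℂ) :=
  {x | x.2 ^ 2 = ∏ k, (x.1 - t k)}

/-- The coefficient `ω_NE / dz` of the one-form `ω_NE` on the surface. It is
`A ∏_{a_j = 1/2} (z - t_j) / w`, that is, the derivative `A ∏ (z - t_j)^{a_j}` of the
Schwarz–Christoffel map on the sheet `w = ∏ (z - t_j)^{1/2}` over the upper half plane. (Where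
`w = 0` this function has its zeros and poles; the formula gives the value `0` at both.) -/
def omegaNE {p : ℕ} (t : Fin (2 * p + 1) → ℝ) (A : ℂ) (x : hyperellipticSurface t) : ℂ :=
  A * (∏ k : Fin (2 * p + 1) with Odd k.val, (x.1.1 - t k)) / x.1.2

/-- The constant `c` in `dh = c dz` is chosen such that `α β = dh²`, where `α = e^{iπ/4} ω_NE` and
`β = e^{iπ/4} φ^* ω_SW`. Over the upper half plane, `ω_NE` and `φ^* ω_SW` are the pull-backs of the
one-form `dζ` of the plane under the Schwarz–Christoffel map `F` and under `φ ∘ F`. -/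
def IsHeightConstant {p : ℕ} (φ : ℂ → ℂ) (t : Fin (2 * p + 1) → ℝ) (A B c : ℂ) : Prop :=
  ∀ z : ℂ, 0 < z.im →
    (exp (Real.pi / 4 * I) * deriv (scMap t A B) z) *
      (exp (Real.pi / 4 * I) * deriv (φ ∘ scMap t A B) z) = c ^ 2

/-- The Gauss map `g = α / dh`, with `α = e^{iπ/4} ω_NE` and `dh = c dz`. -/
def gaussMap {p : ℕ} (t : Fin (2 * p + 1) → ℝ) (A c : ℂ) (x : hyperellipticSurface t) : ℂ :=
  exp (Real.pi / 4 * I) * omegaNE t A x / c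

/-- The singular set `{|g| = 1}` of the maxface with Weierstrass data `g`, `dh`. (The zeros and poles
of `g` are not in it, the function `gaussMap` being `0` at both.) -/
def singularSet {p : ℕ} (t : Fin (2 * p + 1) → ℝ) (A c : ℂ) : Set (hyperellipticSurface t) :=
  {x | ‖gaussMap t A c x‖ = 1}

/-- The rational function `G = (A / c)² ∏ (z - t_j)^{2 a_j}`, for which `g² = i G`. -/
def rationalG {p : ℕ} (t : Fin (2 * p + 1) → ℝ) (A c : ℂ) (z : ℂ) : ℂ :=
  (A / c) ^ 2 * ∏ k : Fin (2 * p + 1), (z - t k) ^ (if Even (k : ℕ) then (-1 : ℤ) else 1)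

end

/-!
The points `t_j` with even and with odd index interlace. Put `E = ∏_{j even} (z - t_j)` and
`O = ∏_{j odd} (z - t_j)`. The surface is `w² = E O`, the Gauss map satisfies
`|g| = |A / c| |O / w|`, and `G = (A / c)² O / E`, so the singular set lies over the level set
`|E / O| = σ` with `σ = |A / c|²`. The constants `A` and `c` are nonzero because `F` and `φ ∘ F` are
injective and holomorphic (`Zigzag.IsOrthoDisk.leadingConstant_ne_zero`,
`IsHeightConstant.ne_zero`).

By interlacing, `E / O` maps the upper half plane to itself
(`im_oddFactor_div_evenFactor`), so it takes real values only on the real line. It is a proper map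
of degree `p + 1` from the complement of its poles to `ℂ` (`isProperMap_div`, `ncard_level`), and
the hypothesis on `G'` says that it has no critical point on the level set. Hence the level set is a
covering of the circle `|v| = σ` with `p + 1` sheets
(`isCoveringMapOn_evenFactor_div_oddFactor`, `card_fiber_evenFactor_div_oddFactor`).

This covering is trivial (`IsCoveringMapOn.exists_circle_sections`): complex conjugation acts on it
and fixes the points over `σ` and over `-σ`, so a lift of the circle is symmetric under the
reflections in both points, and therefore closes up after one turn. This gives `p + 1` disjoint
sections `ζ_k` with `E / O = σ v` at `ζ_k(v)`. On the singular set `w = |A / c| u O` with `|u| = 1`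
(`mem_singularSet_iff`), and then `E / O = σ u²`. So the singular set is the disjoint union of the
loops `u ↦ (ζ_k(u²), |A / c| u O(ζ_k(u²)))`.
-/

/-! ### Nonvanishing of the constants -/

theorem upperHalf_convex : Convex ℝ {z : ℂ | 0 < z.im} := convex_halfSpace_im_gt 0

theorem upperHalf_isOpen : IsOpen {z : ℂ | 0 < z.im} :=
  isOpen_lt continuous_const Complex.continuous_im

theorem Zigzag.isOpen_regionNE {p : ℕ} (Z : Zigzag p) : IsOpen Z.regionNE := by
  have : Z.regionNE = ⋃ q ∈ Z.curve, {z : ℂ | q.re < z.re ∧ q.im < z.im} := by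
    ext z; simp only [Zigzag.regionNE, Set.mem_ofPred_eq, Set.mem_iUnion, exists_prop]
  rw [this]
  refine isOpen_biUnion fun q _ => ?_
  exact (isOpen_lt continuous_const Complex.continuous_re).inter
    (isOpen_lt continuous_const Complex.continuous_im)

theorem differentiableOn_scIntegrand {p : ℕ} (t : Fin (2 * p + 1) → ℝ) :
    DifferentiableOn ℂ (scIntegrand t) {z | 0 < z.im} := by
  intro z hz
  refine DifferentiableAt.differentiableWithinAt ?_
  unfold scIntegrand
  refine DifferentiableAt.fun_finsetProd fun k _ => ?_
  refine DifferentiableAt.cpow_const (by fun_prop) (Or.inr ?_)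
  simpa using hz.ne'

/-- The integrand has a primitive on the half plane, and the integral along the segment from `i` is
its increment. -/
theorem differentiableOn_scMap {p : ℕ} (t : Fin (2 * p + 1) → ℝ) (A B : ℂ) :
    DifferentiableOn ℂ (scMap t A B) {z | 0 < z.im} := by
  obtain ⟨g, hg⟩ :=
    upperHalf_convex.exists_forall_hasDerivWithinAt (differentiableOn_scIntegrand t)
  have hg' : ∀ a : ℂ, 0 < a.im → HasDerivAt g (scIntegrand t a) a := fun a ha =>
    (hg a ha).hasDerivAt (upperHalf_isOpen.mem_nhds ha)
  have key : ∀ z ∈ {z : ℂ | 0 < z.im}, scMap t A B z = A * (g z - g I) + B := by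
    intro z hz
    have hmem : ∀ s ∈ Set.uIcc (0 : ℝ) 1, 0 < (I + s * (z - I)).im := by
      intro s hs
      rw [Set.uIcc_of_le zero_le_one] at hs
      have hz : 0 < z.im := hz
      have : (I + s * (z - I)).im = (1 - s) + s * z.im := by simp; ring
      rw [this]
      rcases hs.1.eq_or_lt with h | h
      · simp [← h]
      · have := mul_pos h hz
        linarith [hs.2]
    have hder : ∀ s ∈ Set.uIcc (0 : ℝ) 1, HasDerivAt (fun s : ℝ => g (I + s * (z - I)))
        (scIntegrand t (I + s * (z - I)) * (z - I)) s := by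
      intro s hs
      have h1 : HasDerivAt (fun s : ℝ => I + s * (z - I)) (z - I) s := by
        simpa using ((Complex.ofRealCLM.hasDerivAt (x := s)).mul_const (z - I)).const_add I
      exact (hg' _ (hmem s hs)).comp s h1
    have hint : IntervalIntegrable (fun s : ℝ => scIntegrand t (I + s * (z - I)) * (z - I))
        MeasureTheory.volume 0 1 := by
      refine ContinuousOn.intervalIntegrable (ContinuousOn.mul ?_ continuousOn_const)
      exact (differentiableOn_scIntegrand t).continuousOn.comp (by fun_prop) hmem
    have := intervalIntegral.integral_eq_sub_of_hasDerivAt hder hint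
    simp only [scMap, this]
    simp
  refine DifferentiableOn.congr ?_ key
  intro z hz
  exact ((((hg' z hz).differentiableAt.sub_const _).const_mul A).add_const
    B).differentiableWithinAt

/-- An injective differentiable function on the half plane is not constant. -/
theorem not_forall_deriv_eq_zero_of_injOn {f : ℂ → ℂ}
    (hd : DifferentiableOn ℂ f {z | 0 < z.im}) (hf : Set.InjOn f {z | 0 < z.im}) :
    ¬ ∀ z ∈ {z : ℂ | 0 < z.im}, deriv f z = 0 := by
  intro h
  have h1 : I ∈ {z : ℂ | 0 < z.im} := by simp
  have h2 : 2 * I ∈ {z : ℂ | 0 < z.im} := by simp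
  have := hf h1 h2 (upperHalf_isOpen.is_const_of_deriv_eq_zero upperHalf_convex.isPreconnected
    hd h h1 h2)
  have := congrArg Complex.im this
  norm_num at this

theorem Zigzag.IsOrthoDisk.leadingConstant_ne_zero {p : ℕ} {Z : Zigzag p}
    {t : Fin (2 * p + 1) → ℝ} {A B : ℂ} (ht : Z.IsOrthoDisk t A B) : A ≠ 0 := by
  rintro rfl
  have h1 : I ∈ {z : ℂ | 0 < z.im} := by simp
  have h2 : 2 * I ∈ {z : ℂ | 0 < z.im} := by simp
  have := congrArg Complex.im (ht.bijOn.injOn h1 h2 (by simp [scMap]))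
  norm_num at this

/-- If `dh` vanished, one of the holomorphic functions `F'` and `(φ ∘ F)'` would vanish identically
on the half plane, although `F` and `φ ∘ F` are injective. -/
theorem IsHeightConstant.ne_zero {p : ℕ} {Z : Zigzag p} {φ : ℂ → ℂ} (hφ : Z.IsReflexiveMap φ)
    {t : Fin (2 * p + 1) → ℝ} {A B c : ℂ} (ht : Z.IsOrthoDisk t A B)
    (hc : IsHeightConstant φ t A B c) : c ≠ 0 := by
  rintro rfl
  have hF := differentiableOn_scMap t A B
  have hψ : DifferentiableOn ℂ (φ ∘ scMap t A B) {z | 0 < z.im} :=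
    hφ.differentiableOn.comp hF ht.bijOn.mapsTo
  have hψi : Set.InjOn (φ ∘ scMap t A B) {z | 0 < z.im} :=
    hφ.bijOn.injOn.comp ht.bijOn.injOn ht.bijOn.mapsTo
  have hmul : ∀ z ∈ {z : ℂ | 0 < z.im},
      deriv (scMap t A B) z * deriv (φ ∘ scMap t A B) z = 0 := by
    intro z hz
    have := hc z hz
    simpa [Complex.exp_ne_zero] using this
  rcases ((hF.deriv upperHalf_isOpen).analyticOnNhd upperHalf_isOpen).eq_zero_or_eq_zero_of_mul_eq_zero
    ((hψ.deriv upperHalf_isOpen).analyticOnNhd upperHalf_isOpen) hmul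
    upperHalf_convex.isPreconnected with h | h
  · exact not_forall_deriv_eq_zero_of_injOn hF ht.bijOn.injOn h
  · exact not_forall_deriv_eq_zero_of_injOn hψ hψi h

/-! ### Coverings of a circle with a real structure -/

/-- Two lifts of a continuous map from the line that agree at one point are equal. -/
theorem IsCoveringMapOn.lift_unique {E X : Type*} [TopologicalSpace E] [TopologicalSpace X]
    {f : E → X} {s : Set X} (hf : IsCoveringMapOn f s) {F₁ F₂ : ℝ → E} (h₁ : Continuous F₁)
    (h₂ : Continuous F₂) (hs : ∀ a, f (F₁ a) ∈ s) (h : ∀ a, f (F₁ a) = f (F₂ a)) {a₀ : ℝ}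
    (h₀ : F₁ a₀ = F₂ a₀) : F₁ = F₂ := by
  have hc : Continuous fun a => f (F₁ a) := by
    rw [continuous_iff_continuousAt]
    exact fun a => (hf.continuousAt (hs a)).comp h₁.continuousAt
  have := (hf.existsUnique_continuousMap_lifts ⟨fun a => f (F₁ a), hc⟩ (a₀ := a₀) rfl
    hs).unique (y₁ := ⟨F₁, h₁⟩) (y₂ := ⟨F₂, h₂⟩) ⟨rfl, rfl⟩ ⟨h₀.symm, funext fun a => (h a).symm⟩
  exact congrArg DFunLike.coe this

/-- A covering of a circle in `ℂ` on which complex conjugation lifts to a map `τ` fixing the points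
over the two real points of the circle is trivial. Indeed, let `F` be a lift of `θ ↦ σ e^{iθ}`.
Since `τ` fixes `F 0` and `F π`, unique lifting gives `τ (F (-θ)) = F θ = τ (F (2π - θ))`, so that
`F` has period `2π`. -/
theorem IsCoveringMapOn.exists_circle_sections {E : Type*} [TopologicalSpace E] {f : E → ℂ} {σ : ℝ}
    (hf : IsCoveringMapOn f (Metric.sphere 0 σ)) (hσ : 0 < σ) {τ : E → E} (hτ : Continuous τ)
    (hfτ : ∀ x, f (τ x) = (starRingEnd ℂ) (f x)) (hfix : ∀ x, (f x).im = 0 → τ x = x) :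
    ∃ ζ : f ⁻¹' {(σ : ℂ)} → C(Circle, E), (∀ k u, f (ζ k u) = σ * u) ∧
      (∀ u k l, ζ k u = ζ l u → k = l) ∧
      (∀ (u : Circle) x, f x = σ * u → ∃ k, ζ k u = x) := by
  let γ : C(ℝ, ℂ) := ⟨fun θ => σ * Circle.exp θ, by fun_prop⟩
  have hγ : ∀ θ, γ θ = σ * Circle.exp θ := fun _ => rfl
  have hγs : ∀ θ, γ θ ∈ Metric.sphere (0 : ℂ) σ := by
    intro θ
    simp [hγ, abs_of_pos hσ]
  have hlift : ∀ (θ : ℝ) (x : E), f x = γ θ →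
      ∃ F : C(ℝ, E), F θ = x ∧ ∀ a, f (F a) = γ a := by
    intro θ x hx
    obtain ⟨F, ⟨h1, h2⟩, -⟩ := hf.existsUnique_continuousMap_lifts γ hx hγs
    exact ⟨F, h1, fun a => congrFun h2 a⟩
  -- reflection of a lift in a real point `a₀` of the circle
  have hrefl : ∀ (F : C(ℝ, E)) (a₀ : ℝ), (∀ a, f (F a) = γ a) → (γ a₀).im = 0 →
      (∀ a, (starRingEnd ℂ) (γ (2 * a₀ - a)) = γ a) → ∀ a, τ (F (2 * a₀ - a)) = F a := by
    intro F a₀ hF him hconj a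
    have hl : ∀ a, f (τ (F (2 * a₀ - a))) = γ a := fun a => by rw [hfτ, hF, hconj]
    refine congrFun (hf.lift_unique (F₁ := fun a => τ (F (2 * a₀ - a))) (F₂ := F)
      (by fun_prop) (by fun_prop) (fun a => ?_) (fun a => ?_) (a₀ := a₀) ?_) a
    · rw [hl]; exact hγs a
    · rw [hl, hF]
    · have : 2 * a₀ - a₀ = a₀ := by ring
      rw [this]
      exact hfix _ (by rw [hF]; exact him)
  have hconj : ∀ a, (starRingEnd ℂ) (γ (-a)) = γ a := by
    intro a
    rw [hγ, hγ, Circle.exp_neg, Circle.coe_inv_eq_conj, map_mul, Complex.conj_conj,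
      Complex.conj_ofReal]
  have hper : ∀ F : C(ℝ, E), (∀ a, f (F a) = γ a) → Function.Periodic F (2 * Real.pi) := by
    intro F hF a
    have h0 := hrefl F 0 hF (by simp [hγ]) (fun a => by
      rw [mul_zero, zero_sub]; exact hconj a) a
    have h1 := hrefl F Real.pi hF (by simp [hγ]) (fun a => by
      rw [← hconj a, hγ, hγ, sub_eq_neg_add, Circle.exp_add, Circle.exp_two_pi, mul_one])
      (a + 2 * Real.pi)
    rw [mul_zero, zero_sub] at h0
    rw [sub_add_cancel_right] at h1
    rw [← h1, h0]
  have hq : IsQuotientMap (Circle.exp : ℝ → Circle) :=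
    Circle.isCoveringMap_exp.isQuotientMap Circle.exp_surjective
  have hdesc : ∀ F : C(ℝ, E), (∀ a, f (F a) = γ a) →
      ∃ G : C(Circle, E), ∀ a, G (Circle.exp a) = F a := by
    intro F hF
    have hcompat : ∀ a b, Circle.exp a = Circle.exp b → F a = F b := by
      intro a b hab
      obtain ⟨m, hm⟩ := Circle.exp_eq_exp.1 hab
      rw [hm]
      exact (hper F hF).int_mul m b
    refine ⟨IsQuotientMap.lift (f := Circle.exp) hq F hcompat, fun a => ?_⟩
    exact congrArg (fun g : C(ℝ, E) => g a) (IsQuotientMap.lift_comp (f := Circle.exp) hq F hcompat)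
  choose F hF0 hF using fun x : f ⁻¹' {(σ : ℂ)} => hlift 0 x.1 (by
    rw [hγ, Circle.exp_zero, Circle.coe_one, mul_one]; exact x.2)
  choose G hG using fun k => hdesc (F k) (hF k)
  refine ⟨G, fun k u => ?_, fun u k l h => ?_, fun u x hx => ?_⟩
  · obtain ⟨a, rfl⟩ := Circle.exp_surjective u
    rw [hG, hF, hγ]
  · obtain ⟨a, rfl⟩ := Circle.exp_surjective u
    rw [hG, hG] at h
    have := hf.lift_unique (F k).continuous (F l).continuous
      (fun a => by rw [hF]; exact hγs a) (fun a => by rw [hF, hF]) h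
    apply Subtype.ext
    rw [← hF0 k, ← hF0 l, this]
  · obtain ⟨a, rfl⟩ := Circle.exp_surjective u
    obtain ⟨H, hHa, hH⟩ := hlift a x hx
    refine ⟨⟨H 0, by simp [hH, hγ]⟩, ?_⟩
    rw [hG, ← hHa]
    refine congrFun (hf.lift_unique (F _).continuous H.continuous
      (fun a => by rw [hF]; exact hγs a) (fun a => by rw [hF, hH]) (a₀ := 0) ?_) a
    rw [hF0]

/-! ### The rational function of an interlacing configuration -/

@[to_additive]
theorem Fin.prod_univ_castSucc_castSucc {M : Type*} [CommMonoid M] {p : ℕ}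
    (f : Fin (2 * (p + 1) + 1) → M) :
    ∏ k, f k = (∏ k : Fin (2 * p + 1), f k.castSucc.castSucc) *
      f (Fin.last (2 * p + 1)).castSucc * f (Fin.last (2 * (p + 1))) :=
  (Fin.prod_univ_castSucc (n := 2 * p + 2) f).trans
    (congrArg (· * _) (Fin.prod_univ_castSucc (n := 2 * p + 1) _))

/-- The product of the linear factors `z - t_k` with even index. -/
noncomputable def evenFactor {p : ℕ} (t : Fin (2 * p + 1) → ℝ) (z : ℂ) : ℂ :=
  ∏ k : Fin (2 * p + 1) with Even k.val, (z - t k)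

/-- The product of the linear factors `z - t_k` with odd index. -/
noncomputable def oddFactor {p : ℕ} (t : Fin (2 * p + 1) → ℝ) (z : ℂ) : ℂ :=
  ∏ k : Fin (2 * p + 1) with Odd k.val, (z - t k)

theorem evenFactor_mul_oddFactor {p : ℕ} (t : Fin (2 * p + 1) → ℝ) (z : ℂ) :
    evenFactor t z * oddFactor t z = ∏ k, (z - t k) := by
  simp only [evenFactor, oddFactor, ← Nat.not_even_iff_odd]
  exact Finset.prod_filter_mul_prod_filter_not _ _ _

theorem differentiable_evenFactor {p : ℕ} (t : Fin (2 * p + 1) → ℝ) :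
    Differentiable ℂ (evenFactor t) := by
  unfold evenFactor; fun_prop

theorem differentiable_oddFactor {p : ℕ} (t : Fin (2 * p + 1) → ℝ) :
    Differentiable ℂ (oddFactor t) := by
  unfold oddFactor; fun_prop

theorem evenFactor_conj {p : ℕ} (t : Fin (2 * p + 1) → ℝ) (z : ℂ) :
    evenFactor t ((starRingEnd ℂ) z) = (starRingEnd ℂ) (evenFactor t z) := by
  simp [evenFactor, map_prod]

theorem oddFactor_conj {p : ℕ} (t : Fin (2 * p + 1) → ℝ) (z : ℂ) :
    oddFactor t ((starRingEnd ℂ) z) = (starRingEnd ℂ) (oddFactor t z) := by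
  simp [oddFactor, map_prod]

theorem oddFactor_ne_zero_of_evenFactor_eq_zero {p : ℕ} {t : Fin (2 * p + 1) → ℝ}
    (ht : StrictMono t) {z : ℂ} (h : evenFactor t z = 0) : oddFactor t z ≠ 0 := by
  intro h'
  obtain ⟨k, hk, hk'⟩ := Finset.prod_eq_zero_iff.1 h
  obtain ⟨l, hl, hl'⟩ := Finset.prod_eq_zero_iff.1 h'
  have hkl : t k = t l := by
    exact_mod_cast (sub_eq_zero.1 hk').symm.trans (sub_eq_zero.1 hl')
  have := ht.injective hkl
  subst this
  simp only [Finset.mem_filter, Finset.mem_univ, true_and] at hk hl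
  exact Nat.not_even_iff_odd.2 hl hk

theorem evenFactor_succ {p : ℕ} (t : Fin (2 * (p + 1) + 1) → ℝ) (z : ℂ) :
    evenFactor t z = evenFactor (p := p) (fun k => t k.castSucc.castSucc) z *
      (z - t (Fin.last _)) := by
  simp only [evenFactor, Finset.prod_filter]
  rw [Fin.prod_univ_castSucc_castSucc]
  simp

theorem oddFactor_succ {p : ℕ} (t : Fin (2 * (p + 1) + 1) → ℝ) (z : ℂ) :
    oddFactor t z = oddFactor (p := p) (fun k => t k.castSucc.castSucc) z *
      (z - t (Fin.last (2 * p + 1)).castSucc) := by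
  simp only [oddFactor, Finset.prod_filter]
  rw [Fin.prod_univ_castSucc_castSucc]
  simp

/-- The quotient of the odd by the even factor maps the upper half plane to the lower one. The
induction adds two larger points `a < b` and the factor `(z - a) / (z - b)`; it keeps the argument
of the quotient between minus that of `z - t_{2p}` and `0`. -/
theorem im_oddFactor_div_evenFactor {p : ℕ} {t : Fin (2 * p + 1) → ℝ} (ht : StrictMono t) {z : ℂ}
    (hz : 0 < z.im) : (oddFactor t z / evenFactor t z).im < 0 ∧
      0 ≤ (oddFactor t z / evenFactor t z * (z - t (Fin.last _))).im := by
  have hne : ∀ a : ℝ, z - a ≠ 0 := fun a h => by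
    have := congrArg Complex.im h
    simp at this
    exact hz.ne' this
  induction p with
  | zero =>
    have h0 : evenFactor t z = z - t 0 := by
      simp [evenFactor]
    have h1 : oddFactor t z = 1 := by
      simp [oddFactor]
    rw [h0, h1]
    refine ⟨?_, ?_⟩
    · rw [one_div, Complex.inv_im]
      have := Complex.normSq_pos.2 (hne (t 0))
      refine div_neg_of_neg_of_pos ?_ this
      simpa using hz
    · rw [one_div]
      change 0 ≤ ((z - t 0)⁻¹ * (z - t 0)).im
      rw [inv_mul_cancel₀ (hne _)]
      simp
  | succ p ih =>
    obtain ⟨h1, h2⟩ := ih (t := fun k => t k.castSucc.castSucc)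
      (fun i j hij => ht (by simpa using hij))
    rw [evenFactor_succ, oddFactor_succ]
    set R := oddFactor (p := p) (fun k => t k.castSucc.castSucc) z /
      evenFactor (p := p) (fun k => t k.castSucc.castSucc) z
    set l := t (Fin.last (2 * p)).castSucc.castSucc with hl
    set a := t (Fin.last (2 * p + 1)).castSucc with ha
    set b := t (Fin.last (2 * (p + 1)))
    have hla : l < a := ht (by rw [Fin.lt_def]; simp)
    have hab : a < b := ht (Fin.castSucc_lt_last _)
    rw [mul_div_mul_comm]
    have hW : 0 < (R * (z - a)).im := by
      have : (R * (z - a)).im = (R * (z - l)).im + (l - a) * R.im := by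
        simp; ring
      rw [this]
      have := mul_pos_of_neg_of_neg (sub_neg.2 hla) h1
      linarith
    refine ⟨?_, ?_⟩
    · have e : R * ((z - a) / (z - b)) = R * (z - a) / (z - b) := by ring
      have hR : R = R * (z - a) / (z - a) := (mul_div_cancel_right₀ _ (hne a)).symm
      rw [e]
      rw [hR] at h1
      generalize R * (z - a) = W at hW h1
      rw [Complex.div_im, ← sub_div] at h1 ⊢
      have hna := Complex.normSq_pos.2 (hne a)
      have hnb := Complex.normSq_pos.2 (hne b)
      have h1 := (div_lt_iff₀ hna).1 h1
      refine div_neg_of_neg_of_pos ?_ hnb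
      simp at h1 ⊢
      nlinarith [mul_pos (sub_pos.2 hab) hW]
    · rw [mul_assoc, div_mul_cancel₀ _ (hne b)]
      exact hW.le

theorem tendsto_evenFactor_div_oddFactor {p : ℕ} (t : Fin (2 * p + 1) → ℝ) :
    Tendsto (fun z => evenFactor t z / oddFactor t z) (cobounded ℂ) (cobounded ℂ) := by
  have hsub : ∀ a : ℝ, Tendsto (fun z : ℂ => z - a) (cobounded ℂ) (cobounded ℂ) :=
    fun a => tendsto_sub_const_cobounded _
  induction p with
  | zero =>
    refine (hsub (t 0)).congr fun z => ?_
    simp [evenFactor, oddFactor]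
  | succ p ih =>
    set a := t (Fin.last (2 * p + 1)).castSucc with ha
    set b := t (Fin.last (2 * (p + 1))) with hb
    have h1 : Tendsto (fun z : ℂ => 1 + (a - b) * (z - a)⁻¹) (cobounded ℂ) (𝓝 1) := by
      simpa using ((tendsto_inv₀_cobounded.comp (hsub a)).const_mul ((a : ℂ) - b)).const_add 1
    have h0 := tendsto_norm_cobounded_atTop.comp (ih fun k => t k.castSucc.castSucc)
    rw [← tendsto_norm_atTop_iff_cobounded]
    refine (h0.atTop_mul_pos (C := 1) one_pos (by simpa using h1.norm)).congr' ?_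
    have hev : ∀ᶠ z : ℂ in cobounded ℂ, z ≠ a :=
      isBounded_def.1 (isBounded_singleton (x := (a : ℂ)))
    filter_upwards [hev] with z hz
    have : z - a ≠ 0 := sub_ne_zero.2 hz
    rw [evenFactor_succ, oddFactor_succ, mul_div_mul_comm, ← ha, ← hb, norm_mul]
    refine congrArg₂ (· * ·) rfl (congrArg norm ?_)
    field_simp
    ring

/-- The quotient of two functions without common zeros is proper off the zeros of the denominator
if it has a pole at infinity. -/
theorem isProperMap_div {P Q : ℂ → ℂ} (hP : Continuous P) (hQ : Continuous Q)
    (hPQ : ∀ z, Q z = 0 → P z ≠ 0)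
    (hlim : Tendsto (fun z => P z / Q z) (cobounded ℂ) (cobounded ℂ)) :
    IsProperMap (fun z : {z : ℂ // Q z ≠ 0} => P z / Q z) := by
  rw [isProperMap_iff_isCompact_preimage]
  refine ⟨(hP.comp continuous_subtype_val).div (hQ.comp continuous_subtype_val) fun z => z.2,
    fun K hK => ?_⟩
  rw [Subtype.isCompact_iff]
  have hbdd : IsBounded ((fun z => P z / Q z) ⁻¹' K) := by
    rw [isBounded_def, ← Set.preimage_compl]
    exact hlim (isBounded_def.1 hK.isBounded)
  -- the equation `P z = v * Q z` remains meaningful, and closed, at the zeros of `Q`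
  have hcl : IsCompact ((closure ((fun z => P z / Q z) ⁻¹' K) ×ˢ K) ∩
      {x : ℂ × ℂ | P x.1 = x.2 * Q x.1}) :=
    (hbdd.isCompact_closure.prod hK).inter_right (isClosed_eq (by fun_prop) (by fun_prop))
  convert hcl.image continuous_fst using 1
  ext z
  constructor
  · rintro ⟨⟨z, hz⟩, hzK, rfl⟩
    exact ⟨(z, P z / Q z), ⟨⟨subset_closure hzK, hzK⟩, (div_mul_cancel₀ _ hz).symm⟩, rfl⟩
  · rintro ⟨⟨z, v⟩, ⟨⟨-, hv⟩, hz⟩, rfl⟩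
    have hz : P z = v * Q z := hz
    have hQz : Q z ≠ 0 := fun h => hPQ z h (by rw [hz, h, mul_zero])
    exact ⟨⟨z, hQz⟩, by simpa [hz, hQz] using hv, rfl⟩

theorem card_filter_even_fin (p : ℕ) :
    (Finset.univ.filter fun k : Fin (2 * p + 1) => Even k.val).card = p + 1 := by
  induction p with
  | zero => simp
  | succ p ih =>
    rw [Finset.card_filter, Fin.sum_univ_castSucc_castSucc]
    simp [ih]

theorem card_filter_odd_fin (p : ℕ) :
    (Finset.univ.filter fun k : Fin (2 * p + 1) => Odd k.val).card = p := by
  induction p with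
  | zero => simp
  | succ p ih =>
    rw [Finset.card_filter] at ih ⊢
    rw [Fin.sum_univ_castSucc_castSucc]
    simpa [← Nat.not_even_iff_odd] using ih

open Polynomial in
/-- A value of the quotient of the even by the odd factor that is attained without multiplicity is
attained `p + 1` times. -/
theorem ncard_level {p : ℕ} {t : Fin (2 * p + 1) → ℝ} (v : ℂ)
    (hv : ∀ z, evenFactor t z = v * oddFactor t z →
      deriv (evenFactor t) z ≠ v * deriv (oddFactor t) z) :
    {z : ℂ | evenFactor t z = v * oddFactor t z}.ncard = p + 1 := by
  set P : ℂ[X] := ∏ k : Fin (2 * p + 1) with Even k.val, (X - C (t k : ℂ)) with hP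
  set Q : ℂ[X] := ∏ k : Fin (2 * p + 1) with Odd k.val, (X - C (t k : ℂ)) with hQ
  have hPe : (fun z => P.eval z) = evenFactor t := by
    ext z; simp [hP, evenFactor, eval_prod]
  have hQe : (fun z => Q.eval z) = oddFactor t := by
    ext z; simp [hQ, oddFactor, eval_prod]
  have hPd : P.natDegree = p + 1 := by
    rw [hP, natDegree_finsetProd_X_sub_C_eq_card, card_filter_even_fin]
  have hQd : Q.natDegree = p := by
    rw [hQ, natDegree_finsetProd_X_sub_C_eq_card, card_filter_odd_fin]
  set D : ℂ[X] := P - C v * Q with hD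
  have hDd : D.natDegree = p + 1 := by
    rw [hD, natDegree_sub_eq_left_of_natDegree_lt, hPd]
    calc (C v * Q).natDegree ≤ Q.natDegree := natDegree_C_mul_le _ _
      _ < P.natDegree := by omega
  have hD0 : D ≠ 0 := by
    rintro h
    rw [h] at hDd
    simp at hDd
  have hDe : ∀ z, D.IsRoot z ↔ evenFactor t z = v * oddFactor t z := by
    intro z
    simp [hD, ← hPe, ← hQe, sub_eq_zero]
  have hnd : D.roots.Nodup := by
    rw [Multiset.nodup_iff_count_le_one]
    intro z
    rw [count_roots]
    by_contra! h
    obtain ⟨h1, h2⟩ := (one_lt_rootMultiplicity_iff_isRoot hD0).1 h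
    refine hv z ((hDe z).1 h1) ?_
    rw [← hPe, ← hQe, Polynomial.deriv, Polynomial.deriv]
    simpa [hD, sub_eq_zero] using h2
  have hset : {z : ℂ | evenFactor t z = v * oddFactor t z} = (D.roots.toFinset : Set ℂ) := by
    ext z
    simp [hD0, ← hDe]
  rw [hset, Set.ncard_coe_finset, Multiset.toFinset_card_of_nodup hnd,
    IsAlgClosed.card_roots_eq_natDegree, hDd]

/-- The quotient of the even by the odd factor is real only on the real line. -/
theorem im_eq_zero_of_im_evenFactor_div_oddFactor_eq_zero {p : ℕ} {t : Fin (2 * p + 1) → ℝ}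
    (ht : StrictMono t) {z : ℂ} (h : (evenFactor t z / oddFactor t z).im = 0) : z.im = 0 := by
  have key : ∀ w : ℂ, 0 < w.im → (evenFactor t w / oddFactor t w).im ≠ 0 := by
    intro w hw h
    have h1 := (im_oddFactor_div_evenFactor ht hw).1
    rw [← inv_div, Complex.inv_im, h] at h1
    simp at h1
  rcases lt_trichotomy z.im 0 with hz | hz | hz
  · refine absurd ?_ (key ((starRingEnd ℂ) z) (by simpa using hz))
    rw [evenFactor_conj, oddFactor_conj, ← map_div₀, Complex.conj_im, h, neg_zero]
  · exact hz
  · exact absurd h (key z hz)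

/-! ### The level set as a covering of the circle -/

/-- A level circle of the quotient of the even by the odd factor without critical points is covered
by the level set. -/
theorem isCoveringMapOn_evenFactor_div_oddFactor {p : ℕ} {t : Fin (2 * p + 1) → ℝ}
    (ht : StrictMono t) {σ : ℝ}
    (hreg : ∀ z, ‖evenFactor t z / oddFactor t z‖ = σ → oddFactor t z ≠ 0 →
      deriv (evenFactor t) z * oddFactor t z - evenFactor t z * deriv (oddFactor t) z ≠ 0) :
    IsCoveringMapOn (fun z : {z : ℂ // oddFactor t z ≠ 0} => evenFactor t z / oddFactor t z)
      (Metric.sphere 0 σ) := by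
  have hopen : IsOpen {z : ℂ | oddFactor t z ≠ 0} :=
    isOpen_ne_fun (differentiable_oddFactor t).continuous continuous_const
  have hproper := isProperMap_div (differentiable_evenFactor t).continuous
    (differentiable_oddFactor t).continuous
    (fun z h h' => oddFactor_ne_zero_of_evenFactor_eq_zero ht h' h)
    (tendsto_evenFactor_div_oddFactor t)
  have hloc : IsLocalHomeomorphOn
      (fun z : {z : ℂ // oddFactor t z ≠ 0} => evenFactor t z / oddFactor t z)
      ((fun z : {z : ℂ // oddFactor t z ≠ 0} => evenFactor t z / oddFactor t z) ⁻¹'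
        Metric.sphere 0 σ) := by
    have hbase : IsLocalHomeomorphOn (fun z => evenFactor t z / oddFactor t z)
        {z | oddFactor t z ≠ 0 ∧ ‖evenFactor t z / oddFactor t z‖ = σ} := by
      rintro z ⟨hz, hzσ⟩
      have hd := (((differentiable_evenFactor t).analyticAt z).hasStrictDerivAt.div
        ((differentiable_oddFactor t).analyticAt z).hasStrictDerivAt hz).hasStrictFDerivAt_equiv
        (div_ne_zero (hreg z hzσ hz) (pow_ne_zero 2 hz))
      exact ⟨_, hd.mem_toOpenPartialHomeomorph_source, rfl⟩
    exact hbase.comp (f := Subtype.val)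
      (hopen.isOpenEmbedding_subtypeVal.isLocalHomeomorph.isLocalHomeomorphOn.mono
        (Set.subset_univ _)) fun z hz => ⟨z.2, by simpa using hz⟩
  refine hproper.isClosedMap.isCoveringMapOn_of_isLocalHomeomorphOn (fun v hv => ?_) hloc
  refine IsCompact.finite ?_ (hloc.mono (Set.preimage_mono (by simpa using hv))
    |>.isDiscrete_of_image ?_)
  · exact hproper.isCompact_preimage isCompact_singleton
  · exact (Set.subsingleton_singleton.anti (Set.image_preimage_subset _ _)).isDiscrete

/-- The fibres have `p + 1` points. -/
theorem card_fiber_evenFactor_div_oddFactor {p : ℕ} {t : Fin (2 * p + 1) → ℝ}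
    (ht : StrictMono t) (v : ℂ)
    (hreg : ∀ z, evenFactor t z / oddFactor t z = v → oddFactor t z ≠ 0 →
      deriv (evenFactor t) z * oddFactor t z - evenFactor t z * deriv (oddFactor t) z ≠ 0) :
    Nat.card ((fun z : {z : ℂ // oddFactor t z ≠ 0} => evenFactor t z / oddFactor t z) ⁻¹' {v}) =
      p + 1 := by
  have hodd : ∀ z, evenFactor t z = v * oddFactor t z → oddFactor t z ≠ 0 := fun z hz h =>
    oddFactor_ne_zero_of_evenFactor_eq_zero ht (by rw [hz, h, mul_zero]) h
  rw [Nat.card_coe_set_eq, ← Set.ncard_image_of_injective _ Subtype.val_injective,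
    ← ncard_level (t := t) v fun z hz h => ?_]
  · congr 1
    ext z
    constructor
    · rintro ⟨⟨z, hz⟩, hzv, rfl⟩
      exact (div_eq_iff hz).1 hzv
    · intro hz
      exact ⟨⟨z, hodd z hz⟩, (div_eq_iff (hodd z hz)).2 hz, rfl⟩
  · refine hreg z ((div_eq_iff (hodd z hz)).2 hz) (hodd z hz) ?_
    rw [h, hz]
    ring

/-! ### The singular set -/

theorem rationalG_eq {p : ℕ} (t : Fin (2 * p + 1) → ℝ) (A c z : ℂ) :
    rationalG t A c z = (A / c) ^ 2 * (oddFactor t z / evenFactor t z) := by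
  have : ∀ k : Fin (2 * p + 1), (z - t k) ^ (if Even (k : ℕ) then (-1 : ℤ) else 1) =
      if Even (k : ℕ) then (z - t k)⁻¹ else z - t k := by
    intro k
    split_ifs <;> simp
  simp only [rationalG, this, Finset.prod_ite, Finset.prod_inv_distrib, evenFactor, oddFactor,
    Nat.not_even_iff_odd]
  ring

/-- On the singular set the second coordinate is `|A / c| u ∏ (z - t_k)`, with the product over odd
`k` and with `u` on the unit circle. -/
theorem mem_singularSet_iff {p : ℕ} {t : Fin (2 * p + 1) → ℝ} {A c : ℂ} (hA : A ≠ 0) (hc : c ≠ 0)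
    (x : hyperellipticSurface t) : x ∈ singularSet t A c ↔
      oddFactor t x.1.1 ≠ 0 ∧ ∃ u : Circle, x.1.2 = ‖A / c‖ * u * oddFactor t x.1.1 := by
  have hr : 0 < ‖A / c‖ := norm_pos_iff.2 (div_ne_zero hA hc)
  have hexp : ‖exp (Real.pi / 4 * I)‖ = 1 := by
    have := Complex.norm_exp_ofReal_mul_I (Real.pi / 4)
    push_cast at this
    exact this
  have hg : ‖gaussMap t A c x‖ = ‖A / c‖ * ‖oddFactor t x.1.1‖ / ‖x.1.2‖ := by
    change ‖exp (Real.pi / 4 * I) * (A * oddFactor t x.1.1 / x.1.2) / c‖ = _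
    rw [norm_div, norm_mul, hexp, norm_div, norm_mul, norm_div]
    ring
  change ‖gaussMap t A c x‖ = 1 ↔ _
  rw [hg]
  constructor
  · intro h
    have hQ : oddFactor t x.1.1 ≠ 0 := by
      intro h0
      simp [h0] at h
    have hw : ‖x.1.2‖ ≠ 0 := by
      intro h0
      simp [h0] at h
    refine ⟨hQ, ⟨x.1.2 / (‖A / c‖ * oddFactor t x.1.1), ?_⟩, ?_⟩
    · refine mem_sphere_zero_iff_norm.2 ?_
      rw [norm_div, norm_mul, Complex.norm_real, norm_norm]
      rw [div_eq_one_iff_eq hw] at h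
      rw [h, div_self hw]
    · have : (‖A / c‖ : ℂ) ≠ 0 := by exact_mod_cast hr.ne'
      change _ = _ * (x.1.2 / (‖A / c‖ * oddFactor t x.1.1)) * _
      field_simp
  · rintro ⟨hQ, u, hu⟩
    rw [hu]
    simp only [norm_mul, Complex.norm_real, norm_norm, Circle.norm_coe, mul_one]
    exact div_self (mul_ne_zero hr.ne' (norm_ne_zero_iff.2 hQ))

theorem exists_mem_singularSet {p : ℕ} {t : Fin (2 * p + 1) → ℝ} {A c : ℂ} (hA : A ≠ 0)
    (hc : c ≠ 0) {z : ℂ} (hQ : oddFactor t z ≠ 0)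
    (hz : ‖evenFactor t z / oddFactor t z‖ = ‖A / c‖ ^ 2) :
    ∃ x ∈ singularSet t A c, x.1.1 = z := by
  have hr : ‖A / c‖ ≠ 0 := norm_ne_zero_iff.2 (div_ne_zero hA hc)
  have hrC : (‖A / c‖ : ℂ) ≠ 0 := by exact_mod_cast hr
  obtain ⟨v, hv⟩ := IsAlgClosed.exists_pow_nat_eq
    (evenFactor t z / oddFactor t z / (‖A / c‖ : ℂ) ^ 2) two_pos
  have hv1 : ‖v‖ = 1 := by
    rw [← sq_eq_sq₀ (norm_nonneg v) zero_le_one, ← norm_pow, hv, norm_div, hz, norm_pow,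
      Complex.norm_real, norm_norm, div_self (pow_ne_zero 2 hr), one_pow]
  refine ⟨⟨(z, ‖A / c‖ * v * oddFactor t z), ?_⟩,
    (mem_singularSet_iff hA hc _).2 ⟨hQ, ⟨v, mem_sphere_zero_iff_norm.2 hv1⟩, rfl⟩, rfl⟩
  change _ ^ 2 = ∏ k, (z - t k)
  rw [← evenFactor_mul_oddFactor, mul_pow, mul_pow, hv]
  field_simp

theorem mainTheorem6 (p : ℕ)
    (Z : Zigzag p) (hZ : Z.IsSymmetric)
    (φ : ℂ → ℂ) (hφ : Z.IsReflexiveMap φ)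
    (t : Fin (2 * p + 1) → ℝ) (A B : ℂ) (ht : Z.IsOrthoDisk t A B)
    (c : ℂ) (hc : IsHeightConstant φ t A B c)
    (hG : ∀ x ∈ singularSet t A c, deriv (rationalG t A c) x.1.1 ≠ 0) :
    ∃ L : Fin (p + 1) → Set (hyperellipticSurface t),
      (∀ i, Nonempty (L i ≃ₜ Circle)) ∧
      Pairwise (fun i j => Disjoint (L i) (L j)) ∧
      singularSet t A c = ⋃ i, L i := by
  have hA : A ≠ 0 := ht.leadingConstant_ne_zero
  have hc0 : c ≠ 0 := hc.ne_zero hφ ht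
  have hr : 0 < ‖A / c‖ := norm_pos_iff.2 (div_ne_zero hA hc0)
  have hrC : (‖A / c‖ : ℂ) ≠ 0 := by exact_mod_cast hr.ne'
  have hreg : ∀ z, ‖evenFactor t z / oddFactor t z‖ = ‖A / c‖ ^ 2 → oddFactor t z ≠ 0 →
      deriv (evenFactor t) z * oddFactor t z - evenFactor t z * deriv (oddFactor t) z ≠ 0 := by
    intro z hz hQ h
    obtain ⟨x, hx, rfl⟩ := exists_mem_singularSet hA hc0 hQ hz
    refine hG x hx ?_
    have hP : evenFactor t x.1.1 ≠ 0 := by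
      intro h0
      rw [h0, zero_div, norm_zero] at hz
      exact (pow_pos hr 2).ne hz
    rw [funext (rationalG_eq t A c), deriv_const_mul _ (((differentiable_oddFactor t) _).fun_div
      ((differentiable_evenFactor t) _) hP), deriv_fun_div ((differentiable_oddFactor t) _)
      ((differentiable_evenFactor t) _) hP]
    have : deriv (oddFactor t) x.1.1 * evenFactor t x.1.1 -
        oddFactor t x.1.1 * deriv (evenFactor t) x.1.1 = 0 := by linear_combination -h
    rw [this, zero_div, mul_zero]
  obtain ⟨ζ, hζ, hinj, hsurj⟩ :=
    (isCoveringMapOn_evenFactor_div_oddFactor ht.strictMono hreg).exists_circle_sections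
      (pow_pos hr 2)
      (τ := fun z => ⟨(starRingEnd ℂ) z, by
        rw [oddFactor_conj]; exact (map_ne_zero _).2 z.2⟩)
      (by
        refine Continuous.subtype_mk ?_ _
        exact Complex.continuous_conj.comp continuous_subtype_val)
      (fun z => by simp only [evenFactor_conj, oddFactor_conj, map_div₀])
      (fun z hz => Subtype.ext (Complex.conj_eq_iff_im.2
        (im_eq_zero_of_im_evenFactor_div_oddFactor_eq_zero ht.strictMono hz)))
  have hcard := card_fiber_evenFactor_div_oddFactor ht.strictMono ((‖A / c‖ ^ 2 : ℝ) : ℂ)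
    fun z hz hQ => hreg z (by rw [hz]; simp) hQ
  have hfin := Nat.finite_of_card_ne_zero (hcard.trans_ne p.succ_ne_zero)
  let e := (Finite.equivFinOfCardEq hcard).symm
  -- In terms of `u = w / (|A / c| O)` the quotient `E / O = w² / O²` is `|A / c|² u²`, so the
  -- section is evaluated at `u²`.
  let loop : Fin (p + 1) → Circle → hyperellipticSurface t := fun k u =>
    ⟨(ζ (e k) (u ^ 2), ‖A / c‖ * u * oddFactor t (ζ (e k) (u ^ 2))), by
      have h1 := (div_eq_iff (ζ (e k) (u ^ 2)).2).1 (hζ (e k) (u ^ 2))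
      change (_ * _) ^ 2 = ∏ k, _
      rw [← evenFactor_mul_oddFactor, h1]
      push_cast
      ring⟩
  have hu : ∀ {z : ℂ} {u v : Circle}, oddFactor t z ≠ 0 →
      (‖A / c‖ * u * oddFactor t z : ℂ) = ‖A / c‖ * v * oddFactor t z → u = v := by
    intro z u v hz h
    exact Circle.ext (mul_left_cancel₀ hrC (mul_right_cancel₀ hz h))
  have hloop : ∀ {k l u v}, loop k u = loop l v → k = l ∧ u = v := by
    intro k l u v h
    have h1 : (ζ (e k) (u ^ 2) : ℂ) = ζ (e l) (v ^ 2) := congrArg (fun x => x.1.1) h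
    have h2 : (‖A / c‖ * u * oddFactor t (ζ (e k) (u ^ 2)) : ℂ) =
      ‖A / c‖ * v * oddFactor t (ζ (e l) (v ^ 2)) := congrArg (fun x => x.1.2) h
    rw [← h1] at h2
    obtain rfl := hu (ζ (e k) (u ^ 2)).2 h2
    exact ⟨e.injective (hinj _ _ _ (Subtype.ext h1)), rfl⟩
  have hcont : ∀ k, Continuous (loop k) := by
    intro k
    have h1 : Continuous fun u : Circle => (ζ (e k) (u ^ 2) : ℂ) := by fun_prop
    have h2 : Continuous fun u : Circle => (‖A / c‖ * u : ℂ) := by fun_prop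
    exact (h1.prodMk (h2.mul
      ((differentiable_oddFactor t).continuous.comp h1))).subtype_mk _
  refine ⟨fun k => Set.range (loop k), fun k => ⟨?_⟩, fun k l hkl => ?_, ?_⟩
  · exact ((hcont k).isClosedEmbedding fun u v h => (hloop h).2).isEmbedding.toHomeomorph.symm
  · refine Set.disjoint_left.2 ?_
    rintro _ ⟨u, rfl⟩ ⟨v, hv⟩
    exact hkl (hloop hv).1.symm
  · ext x
    rw [mem_singularSet_iff hA hc0, Set.mem_iUnion]
    constructor
    · rintro ⟨hQ, u, hw⟩
      have hx : x.1.2 ^ 2 = evenFactor t x.1.1 * oddFactor t x.1.1 := by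
        rw [evenFactor_mul_oddFactor]; exact x.2
      obtain ⟨k, hk⟩ := hsurj (u ^ 2) ⟨x.1.1, hQ⟩ (by
        rw [div_eq_iff hQ]
        refine mul_right_cancel₀ hQ ?_
        rw [← hx, hw]
        push_cast
        ring)
      obtain ⟨k, rfl⟩ := e.surjective k
      refine ⟨k, u, Subtype.ext (Prod.ext ?_ ?_)⟩
      · exact congrArg Subtype.val hk
      · change _ * oddFactor t (ζ (e k) (u ^ 2)) = _
        rw [hk, hw]
    · rintro ⟨k, u, rfl⟩
      exact ⟨(ζ (e k) (u ^ 2)).2, u, rfl⟩
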